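/- Let $\mathcal H$ be a complex Hilbert space, let $\Gamma$ be a selfadjoint unitary operator on $\mathcal H$, and put $\gamma(a)=\Gamma a\Gamma^*=\Gamma a\Gamma$ for $a\in B(\mathcal H)$. Let $Q$ be a selfadjoint (possibly unbounded) operator on $\mathcal H$ with domain $D(Q)$ that is odd, i.e. $\Gamma Q\Gamma=-Q$ as unbounded operators. Let $D(\delta)$ be the linear subspace of all $a\in B(\mathcal H)$ for which there is $b\in B(\mathcal H)$ with $$\gamma(a)Q\subset Qa-b .$$ For $a\in D(\delta)$ this $b$ is unique; setting $\delta(a)=b$ defines a linear map $\delta:D(\delta)\to B(\mathcal H)$ (the superderivation $\delta=[Q,\cdot\,]$). Put $\|a\|_1=\|a\|+\|\delta(a)\|$ for $a\in D(\delta)$. Then: * $1\in D(\delta)$ and $\delta(1)=0$. * (i) If $a\in D(\delta)$, then $\gamma(a)\in D(\delta)$ and $\delta(\gamma(a))=-\gamma(\delta(a))$. * (ii) If $a\in D(\delta)$, then $a^*\in D(\delta)$ and $\delta(a^*)=\gamma(\delta(a)^*)$. * (iii) If $a,b\in D(\delta)$, then $ab\in D(\delta)$ and $\delta(ab)=\delta(a)b+\gamma(a)\delta(b)$.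 * (iv) $\delta$ is weak–weak closed: if a net $(a_\lambda)$ in $D(\delta)$ (or, more generally, a family in $D(\delta)$ along a proper filter) is such that $a_\lambda\to a\in B(\mathcal H)$ and $\delta(a_\lambda)\to b\in B(\mathcal H)$ in the weak operator topology, then $a\in D(\delta)$ and $\delta(a)=b$. * (v) $D(\delta)$ is dense in $B(\mathcal H)$ in the strong operator topology. * (vi) If $a,b\in D(\delta)$, then $\|\gamma(a)\|_1=\|a\|_1$, $\|a^*\|_1=\|a\|_1$ and $\|ab\|_1\le\|a\|_1\|b\|_1$. * Consequently $D(\delta)$ is a unital $*$-subalgebra of $B(\mathcal H)$, and with the norm $\|\cdot\|_1$ it is a unital Banach $*$-algebra: $\|\cdot\|_1$ is a complete submultiplicative norm on $D(\delta)$ with isometric involution, and $\|1\|_1=1$ if $\mathcal H\ne 0$. -/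

import Mathlib

noncomputable section

namespace SuperDer

variable {H : Type*} [NormedAddCommGroup H] [InnerProductSpace ℂ H] [CompleteSpace H]

/-- The map `γ = Ad Γ` on `B(H)`, `γ(a) = Γ a Γ*`. -/
def grading (Γ : H →L[ℂ] H) (a : H →L[ℂ] H) : H →L[ℂ] H :=
  Γ * a * star Γ

/-- The product `Q a` of an unbounded operator `Q` and a bounded operator `a`, with its natural
domain `{ψ | a ψ ∈ D(Q)}`. -/
def mulRight (Q : H →ₗ.[ℂ] H) (a : H →L[ℂ] H) : H →ₗ.[ℂ] H where
  domain := Q.domain.comap (a : H →ₗ[ℂ] H)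
  toFun := Q.toFun ∘ₗ
    ((a : H →ₗ[ℂ] H).restrict (p := Q.domain.comap (a : H →ₗ[ℂ] H)) (q := Q.domain)
      (fun _ h => h))

/-- The product `a Q` of a bounded operator `a` and an unbounded operator `Q`, with domain
`D(Q)`. -/
def mulLeft (a : H →L[ℂ] H) (Q : H →ₗ.[ℂ] H) : H →ₗ.[ℂ] H :=
  (a : H →ₗ[ℂ] H).compPMap Q

/-- `Q` is odd for the grading: `Γ Q Γ = -Q`, an equality of unbounded operators. -/
def IsOdd (Γ : H →L[ℂ] H) (Q : H →ₗ.[ℂ] H) : Prop :=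
  mulLeft Γ (mulRight Q Γ) = -Q

/-- The relation `γ(a) Q ⊂ Q a - b` between bounded operators `a`, `b`: the unbounded operator
`Q a - b` (with domain that of `Q a`) extends `γ(a) Q`. -/
def IsSuperCommutator (Γ : H →L[ℂ] H) (Q : H →ₗ.[ℂ] H) (a b : H →L[ℂ] H) : Prop :=
  mulLeft (grading Γ a) Q ≤ mulRight Q a - (b : H →ₗ[ℂ] H).toPMap ⊤

theorem isSuperCommutator_iff (Γ : H →L[ℂ] H) (Q : H →ₗ.[ℂ] H) (a b : H →L[ℂ] H) :
    IsSuperCommutator Γ Q a b ↔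
      ∀ ψ : Q.domain, ∃ h : a ψ ∈ Q.domain, Q ⟨a ψ, h⟩ = grading Γ a (Q ψ) + b ψ := by
  constructor
  · intro h ψ
    have h1 := h.1 ψ.2
    refine ⟨h1.1, ?_⟩
    have h2 := h.2 (x := ψ) (y := ⟨ψ, h1⟩) rfl
    exact (sub_eq_iff_eq_add.1 h2.symm)
  · intro h
    refine ⟨fun x hx => ⟨(h ⟨x, hx⟩).1, trivial⟩, ?_⟩
    rintro ⟨x, hx⟩ ⟨y, hy⟩ hxy
    obtain rfl : x = y := hxy
    exact (sub_eq_iff_eq_add.2 (h ⟨x, hx⟩).2).symm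

/-- The set of all pairs `(a, b)` of bounded operators with `γ(a) Q ⊂ Q a - b`, as a linear
subspace of `B(H) × B(H)`. -/
def superGraph (Γ : H →L[ℂ] H) (Q : H →ₗ.[ℂ] H) : Submodule ℂ ((H →L[ℂ] H) × (H →L[ℂ] H)) where
  carrier := {p | IsSuperCommutator Γ Q p.1 p.2}
  zero_mem' := by
    refine (isSuperCommutator_iff Γ Q 0 0).2 fun ψ => ⟨Q.domain.zero_mem, Q.map_zero.trans ?_⟩
    simp [grading]
  add_mem' := by
    rintro ⟨a, b⟩ ⟨a', b'⟩ h h'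
    refine (isSuperCommutator_iff Γ Q _ _).2 fun ψ => ?_
    obtain ⟨h1, h2⟩ := (isSuperCommutator_iff Γ Q _ _).1 h ψ
    obtain ⟨h1', h2'⟩ := (isSuperCommutator_iff Γ Q _ _).1 h' ψ
    refine ⟨Q.domain.add_mem h1 h1', (Q.map_add ⟨_, h1⟩ ⟨_, h1'⟩).trans ?_⟩
    rw [h2, h2']
    change grading Γ a (Q ψ) + b ψ + (grading Γ a' (Q ψ) + b' ψ) =
      grading Γ (a + a') (Q ψ) + (b ψ + b' ψ)
    have : grading Γ (a + a') (Q ψ) = grading Γ a (Q ψ) + grading Γ a' (Q ψ) := by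
      simp [grading]
    rw [this]
    abel
  smul_mem' := by
    rintro c ⟨a, b⟩ h
    refine (isSuperCommutator_iff Γ Q _ _).2 fun ψ => ?_
    obtain ⟨h1, h2⟩ := (isSuperCommutator_iff Γ Q _ _).1 h ψ
    refine ⟨Q.domain.smul_mem c h1, (Q.map_smul c ⟨_, h1⟩).trans ?_⟩
    rw [h2]
    simp [grading]

/-- The superderivation `δ = [Q, ·]` as a partially defined linear map on `B(H)`: its domain is
the set of all `a` for which some bounded `b` satisfies `γ(a) Q ⊂ Q a - b`, and `δ(a)` is this `b`
(which is unique when `D(Q)` is dense). -/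
def superDer (Γ : H →L[ℂ] H) (Q : H →ₗ.[ℂ] H) : (H →L[ℂ] H) →ₗ.[ℂ] (H →L[ℂ] H) :=
  (superGraph Γ Q).toLinearPMap

/-- The norm `‖a‖₁ = ‖a‖ + ‖δ(a)‖` on `D(δ)`. -/
def norm1 (Γ : H →L[ℂ] H) (Q : H →ₗ.[ℂ] H) (a : (superDer Γ Q).domain) : ℝ :=
  ‖(a : H →L[ℂ] H)‖ + ‖superDer Γ Q a‖

/-- `N` is a norm making the unital complex *-algebra `A` into a unital Banach *-algebra:
a submultiplicative norm for which the unit has norm one (unless `A = 0`), the involution is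
isometric and every Cauchy sequence converges. -/
structure IsBanachStarAlgebraNorm {A : Type*} [Ring A] [Algebra ℂ A] [StarRing A] [StarModule ℂ A]
    (N : A → ℝ) : Prop where
  nonneg : ∀ a, 0 ≤ N a
  eq_zero_iff : ∀ a, N a = 0 ↔ a = 0
  add_le : ∀ a b, N (a + b) ≤ N a + N b
  smul : ∀ (c : ℂ) (a : A), N (c • a) = ‖c‖ * N a
  norm_one : Nontrivial A → N 1 = 1
  mul_le : ∀ a b, N (a * b) ≤ N a * N b
  norm_star : ∀ a, N (star a) = N a
  complete : ∀ x : ℕ → A,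
    (∀ ε : ℝ, 0 < ε → ∃ n₀, ∀ m, n₀ ≤ m → ∀ n, n₀ ≤ n → N (x m - x n) < ε) →
    ∃ a, Filter.Tendsto (fun n => N (x n - a)) Filter.atTop (nhds 0)

end SuperDer

end

namespace SuperDer

variable {H : Type*} [NormedAddCommGroup H] [InnerProductSpace ℂ H] [CompleteSpace H]
  {Γ : H →L[ℂ] H} {Q : H →ₗ.[ℂ] H}

/-! ### Selfadjoint operators -/

/-! Everything rests on two readings of the relation `γ(a) Q ⊂ Q a - b`. Pointwise, it says that `a`
preserves `D(Q)` and `Q a ψ = γ(a) Q ψ + b ψ` there. This gives uniqueness of `b` (`D(Q)` is dense)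
and the rules for the unit, `γ` and products. Since `Q = Q*`, it is equivalent to the identity `⟨Qφ,
aψ⟩ = ⟨φ, γ(a)Qψ + bψ⟩` on `D(Q)` (`isSuperCommutator_iff_inner`). No domain condition on `aψ` is
left and only matrix coefficients of `a` and `b` occur, so adjoints and weak limits can be taken.
Completeness of `‖·‖₁` is then a case of weak closedness. For strong density, rank-one operators
built from vectors of `D(Q)` lie in `D(δ)`. Their norm limits include all rank-one operators, whose
finite sums approximate every bounded operator strongly. -/

theorem inner_map_left_of_isSelfAdjoint (hQ : IsSelfAdjoint Q) (φ ψ : Q.domain) :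
    inner ℂ (Q φ) (ψ : H) = inner ℂ (φ : H) (Q ψ) := by
  have h := LinearPMap.adjoint_isFormalAdjoint hQ.dense_domain
  rw [LinearPMap.isSelfAdjoint_def.1 hQ] at h
  exact h φ ψ

/-- This is the maximality of a selfadjoint operator: `h` puts `x` in the domain of `Q* = Q`, and
density of `D(Q)` identifies the value. -/
theorem exists_map_eq_of_inner (hQ : IsSelfAdjoint Q) {x y : H}
    (h : ∀ φ : Q.domain, inner ℂ (Q φ) x = inner ℂ (φ : H) y) :
    ∃ hx : x ∈ Q.domain, Q ⟨x, hx⟩ = y := by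
  have h' : ∀ φ : Q.domain, inner ℂ y (φ : H) = inner ℂ x (Q φ) := fun φ => by
    rw [← inner_conj_symm, ← h φ, inner_conj_symm]
  have hx : x ∈ Q.domain := by
    rw [← LinearPMap.isSelfAdjoint_def.1 hQ]
    exact LinearPMap.mem_adjoint_domain_of_exists x ⟨y, h'⟩
  refine ⟨hx, hQ.dense_domain.eq_of_inner_right ℂ fun v hv => ?_⟩
  rw [← h ⟨v, hv⟩, inner_map_left_of_isSelfAdjoint hQ ⟨v, hv⟩ ⟨x, hx⟩]

/-! ### The grading -/

theorem involution_apply_apply (hΓ : IsSelfAdjoint Γ) (hΓu : Γ ∈ unitary (H →L[ℂ] H)) (x : H) :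
    Γ (Γ x) = x := by
  have h := (Unitary.mem_iff.1 hΓu).2
  rw [hΓ.star_eq] at h
  exact DFunLike.congr_fun h x

theorem inner_involution_left (hΓ : IsSelfAdjoint Γ) (x y : H) :
    inner ℂ (Γ x) y = inner ℂ x (Γ y) := by
  rw [← ContinuousLinearMap.adjoint_inner_right, ← ContinuousLinearMap.star_eq_adjoint,
    hΓ.star_eq]

theorem grading_apply (hΓ : IsSelfAdjoint Γ) (a : H →L[ℂ] H) (x : H) :
    grading Γ a x = Γ (a (Γ x)) := by
  simp [grading, hΓ.star_eq]

theorem grading_grading (hΓ : IsSelfAdjoint Γ) (hΓu : Γ ∈ unitary (H →L[ℂ] H)) (a : H →L[ℂ] H) :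
    grading Γ (grading Γ a) = a := by
  ext x
  simp [grading_apply hΓ, involution_apply_apply hΓ hΓu]

theorem grading_mul (hΓ : IsSelfAdjoint Γ) (hΓu : Γ ∈ unitary (H →L[ℂ] H)) (a b : H →L[ℂ] H) :
    grading Γ (a * b) = grading Γ a * grading Γ b := by
  ext x
  simp [grading_apply hΓ, involution_apply_apply hΓ hΓu]

theorem star_grading (a : H →L[ℂ] H) : star (grading Γ a) = grading Γ (star a) := by
  simp [grading, mul_assoc]

theorem norm_grading (hΓu : Γ ∈ unitary (H →L[ℂ] H)) (a : H →L[ℂ] H) :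
    ‖grading Γ a‖ = ‖a‖ := by
  rw [grading, CStarRing.norm_mul_mem_unitary _ (Unitary.star_mem hΓu),
    CStarRing.norm_mem_unitary_mul _ hΓu]

theorem map_involution (hΓ : IsSelfAdjoint Γ) (hΓu : Γ ∈ unitary (H →L[ℂ] H)) (hodd : IsOdd Γ Q)
    (ψ : Q.domain) : ∃ h : Γ ψ ∈ Q.domain, Q ⟨Γ ψ, h⟩ = -Γ (Q ψ) := by
  have hle : -Q ≤ mulLeft Γ (mulRight Q Γ) := hodd.ge
  have h : Γ ψ ∈ Q.domain := hle.1 ψ.2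
  refine ⟨h, ?_⟩
  have h2 : -Q ψ = Γ (Q ⟨Γ ψ, h⟩) := hle.2 (x := ψ) (y := ⟨ψ, h⟩) rfl
  rw [← involution_apply_apply hΓ hΓu (Q ⟨Γ ψ, h⟩), ← h2, map_neg]

/-! ### The relation `γ(a) Q ⊂ Q a - b` -/

theorem isSuperCommutator_iff_inner (hQ : IsSelfAdjoint Q) (a b : H →L[ℂ] H) :
    IsSuperCommutator Γ Q a b ↔ ∀ φ ψ : Q.domain,
      inner ℂ (Q φ) (a ψ) = inner ℂ (φ : H) (grading Γ a (Q ψ) + b ψ) := by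
  rw [isSuperCommutator_iff]
  constructor
  · intro h φ ψ
    obtain ⟨h1, h2⟩ := h ψ
    rw [← h2]
    exact inner_map_left_of_isSelfAdjoint hQ φ ⟨a ψ, h1⟩
  · exact fun h ψ => exists_map_eq_of_inner hQ fun φ => h φ ψ

theorem IsSuperCommutator.unique (hQ : IsSelfAdjoint Q) {a b b' : H →L[ℂ] H}
    (h : IsSuperCommutator Γ Q a b) (h' : IsSuperCommutator Γ Q a b') : b = b' := by
  refine ContinuousLinearMap.coeFn_injective
    (b.continuous.ext_on hQ.dense_domain b'.continuous fun ψ hψ => ?_)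
  obtain ⟨h1, h2⟩ := (isSuperCommutator_iff Γ Q a b).1 h ⟨ψ, hψ⟩
  obtain ⟨h1', h2'⟩ := (isSuperCommutator_iff Γ Q a b').1 h' ⟨ψ, hψ⟩
  exact add_left_cancel (h2.symm.trans h2')

theorem isSuperCommutator_one (hΓ : IsSelfAdjoint Γ) (hΓu : Γ ∈ unitary (H →L[ℂ] H)) :
    IsSuperCommutator Γ Q 1 0 :=
  (isSuperCommutator_iff Γ Q 1 0).2 fun ψ =>
    ⟨ψ.2, by simp [grading_apply hΓ, involution_apply_apply hΓ hΓu]⟩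

theorem IsSuperCommutator.grading (hΓ : IsSelfAdjoint Γ) (hΓu : Γ ∈ unitary (H →L[ℂ] H))
    (hodd : IsOdd Γ Q) {a b : H →L[ℂ] H} (h : IsSuperCommutator Γ Q a b) :
    IsSuperCommutator Γ Q (grading Γ a) (-SuperDer.grading Γ b) := by
  refine (isSuperCommutator_iff Γ Q _ _).2 fun ψ => ?_
  obtain ⟨h1, e1⟩ := map_involution hΓ hΓu hodd ψ
  obtain ⟨h2, e2⟩ := (isSuperCommutator_iff Γ Q _ _).1 h ⟨Γ ψ, h1⟩
  obtain ⟨h3, e3⟩ := map_involution hΓ hΓu hodd ⟨_, h2⟩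
  simp only [grading_apply hΓ]
  refine ⟨h3, e3.trans ?_⟩
  simp [e2, e1, grading_apply hΓ, involution_apply_apply hΓ hΓu, add_comm]

theorem IsSuperCommutator.star (hΓ : IsSelfAdjoint Γ) (hΓu : Γ ∈ unitary (H →L[ℂ] H))
    (hQ : IsSelfAdjoint Q) (hodd : IsOdd Γ Q) {a b : H →L[ℂ] H}
    (h : IsSuperCommutator Γ Q a b) :
    IsSuperCommutator Γ Q (star a) (SuperDer.grading Γ (star b)) := by
  refine (isSuperCommutator_iff_inner hQ _ _).2 fun φ ψ => ?_
  -- Starting from `γ(a)` rather than `a` gives `Q γ(a) φ = a Q φ - γ(b) φ`. Pairing this with `ψ`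
  -- and moving the bounded operators across is the weak form for `a*`.
  obtain ⟨h1, e1⟩ := (isSuperCommutator_iff Γ Q _ _).1 (h.grading hΓ hΓu hodd) φ
  rw [grading_grading hΓ hΓu] at e1
  have e2 := inner_map_left_of_isSelfAdjoint hQ ⟨_, h1⟩ ψ
  rw [e1] at e2
  rw [← star_grading, ← star_grading, inner_add_right]
  simp only [ContinuousLinearMap.star_eq_adjoint, ContinuousLinearMap.adjoint_inner_right]
  rw [← e2]
  simp

theorem IsSuperCommutator.mul (hΓ : IsSelfAdjoint Γ) (hΓu : Γ ∈ unitary (H →L[ℂ] H))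
    {a b a' b' : H →L[ℂ] H} (h : IsSuperCommutator Γ Q a b) (h' : IsSuperCommutator Γ Q a' b') :
    IsSuperCommutator Γ Q (a * a') (b * a' + SuperDer.grading Γ a * b') := by
  refine (isSuperCommutator_iff Γ Q _ _).2 fun ψ => ?_
  obtain ⟨h1, e1⟩ := (isSuperCommutator_iff Γ Q _ _).1 h' ψ
  obtain ⟨h2, e2⟩ := (isSuperCommutator_iff Γ Q _ _).1 h ⟨_, h1⟩
  refine ⟨h2, e2.trans ?_⟩
  rw [e1, grading_mul hΓ hΓu]
  rw [map_add, add_assoc, add_comm (SuperDer.grading Γ a (b' ψ))]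
  rfl

open Filter Topology in
theorem isSuperCommutator_of_tendsto (hΓ : IsSelfAdjoint Γ) (hQ : IsSelfAdjoint Q)
    {ι : Type*} {l : Filter ι} [l.NeBot] {x y : ι → H →L[ℂ] H} {a b : H →L[ℂ] H}
    (h : ∀ i, IsSuperCommutator Γ Q (x i) (y i))
    (hx : Tendsto (fun i => ContinuousLinearMapWOT.ofCLM (x i)) l
      (𝓝 (ContinuousLinearMapWOT.ofCLM a)))
    (hy : Tendsto (fun i => ContinuousLinearMapWOT.ofCLM (y i)) l
      (𝓝 (ContinuousLinearMapWOT.ofCLM b))) :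
    IsSuperCommutator Γ Q a b := by
  have hx' : ∀ u v : H, Tendsto (fun i => inner ℂ u (x i v)) l (𝓝 (inner ℂ u (a v))) :=
    fun u v => ContinuousLinearMapWOT.tendsto_iff_forall_dual_apply_tendsto.1 hx v (innerSL ℂ u)
  have hy' : ∀ u v : H, Tendsto (fun i => inner ℂ u (y i v)) l (𝓝 (inner ℂ u (b v))) :=
    fun u v => ContinuousLinearMapWOT.tendsto_iff_forall_dual_apply_tendsto.1 hy v (innerSL ℂ u)
  refine (isSuperCommutator_iff_inner hQ a b).2 fun φ ψ => ?_
  refine tendsto_nhds_unique (hx' (Q φ) ψ) ?_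
  -- Moving the outer `Γ` onto `φ` makes `⟨φ, γ(a)Qψ⟩` the matrix coefficient `⟨Γφ, a ΓQψ⟩`, which
  -- is weakly continuous in `a`.
  simp_rw [(isSuperCommutator_iff_inner hQ _ _).1 (h _) φ ψ, inner_add_right, grading_apply hΓ,
    ← inner_involution_left hΓ]
  exact (hx' _ _).add (hy' _ _)

/-! ### The superderivation -/

/-- Single-valuedness, the condition under which `Submodule.toLinearPMap` has the given subspace as
its graph. -/
theorem superGraph_snd_eq_zero (hQ : IsSelfAdjoint Q)
    (p : (H →L[ℂ] H) × (H →L[ℂ] H)) (hp : p ∈ superGraph Γ Q) (h0 : p.1 = 0) : p.2 = 0 := by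
  have hp' : IsSuperCommutator Γ Q p.1 p.2 := hp
  rw [h0] at hp'
  exact hp'.unique hQ (superGraph Γ Q).zero_mem

theorem graph_superDer (hQ : IsSelfAdjoint Q) : (superDer Γ Q).graph = superGraph Γ Q :=
  Submodule.toLinearPMap_graph_eq _ (superGraph_snd_eq_zero hQ)

theorem mem_domain_superDer_iff (a : H →L[ℂ] H) :
    a ∈ (superDer Γ Q).domain ↔ ∃ b, IsSuperCommutator Γ Q a b := by
  rw [superDer, Submodule.toLinearPMap_domain, Submodule.mem_map]
  constructor
  · rintro ⟨⟨a', b⟩, h, rfl⟩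
    exact ⟨b, h⟩
  · rintro ⟨b, h⟩
    exact ⟨(a, b), h, rfl⟩

theorem isSuperCommutator_superDer (hQ : IsSelfAdjoint Q) (a : (superDer Γ Q).domain) :
    IsSuperCommutator Γ Q a (superDer Γ Q a) := by
  have h := LinearPMap.mem_graph (superDer Γ Q) a
  rw [graph_superDer hQ] at h
  exact h

theorem IsSuperCommutator.exists_superDer_eq (hQ : IsSelfAdjoint Q) {a b : H →L[ℂ] H}
    (h : IsSuperCommutator Γ Q a b) :
    ∃ ha : a ∈ (superDer Γ Q).domain, superDer Γ Q ⟨a, ha⟩ = b :=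
  have ha := (mem_domain_superDer_iff a).2 ⟨b, h⟩
  ⟨ha, (isSuperCommutator_superDer hQ ⟨a, ha⟩).unique hQ h⟩

/-! ### Density of the domain -/

theorem rankOne_mem_domain_superDer (hΓ : IsSelfAdjoint Γ) (hΓu : Γ ∈ unitary (H →L[ℂ] H))
    (hQ : IsSelfAdjoint Q) (hodd : IsOdd Γ Q) (ξ η : Q.domain) :
    InnerProductSpace.rankOne ℂ (ξ : H) (η : H) ∈ (superDer Γ Q).domain := by
  obtain ⟨h1, e1⟩ := map_involution hΓ hΓu hodd η
  -- For `a = |ξ⟩⟨η|`, `Q a ψ = ⟨η, ψ⟩ Qξ`, while `γ(a) Q ψ = ⟨Γη, Qψ⟩ Γξ = ⟨QΓη, ψ⟩ Γξ` because `Γη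
  -- ∈ D(Q)`. Both are bounded in `ψ`; the witness is their difference.
  refine (mem_domain_superDer_iff _).2 ⟨InnerProductSpace.rankOne ℂ (Q ξ) (η : H) -
    InnerProductSpace.rankOne ℂ (Γ ξ) (Q ⟨Γ η, h1⟩), ?_⟩
  refine (isSuperCommutator_iff Γ Q _ _).2 fun ψ => ?_
  have h : InnerProductSpace.rankOne ℂ (ξ : H) (η : H) (ψ : H) ∈ Q.domain := by
    rw [InnerProductSpace.rankOne_apply]
    exact Q.domain.smul_mem _ ξ.2
  refine ⟨h, ?_⟩
  have e : (⟨_, h⟩ : Q.domain) = inner ℂ (η : H) (ψ : H) • ξ := by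
    ext
    simp [InnerProductSpace.rankOne_apply]
  rw [e, LinearPMap.map_smul]
  simp [grading_apply hΓ, InnerProductSpace.rankOne_apply, ← inner_involution_left hΓ,
    inner_map_left_of_isSelfAdjoint hQ ⟨Γ η, h1⟩ ψ]

/-- The closure is in operator norm. Rank-one operators depend continuously on each vector, so the
two vectors are approximated from `D(Q)` one at a time. -/
theorem rankOne_mem_closure_domain_superDer (hΓ : IsSelfAdjoint Γ)
    (hΓu : Γ ∈ unitary (H →L[ℂ] H)) (hQ : IsSelfAdjoint Q) (hodd : IsOdd Γ Q) (x y : H) :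
    InnerProductSpace.rankOne ℂ x y ∈ (superDer Γ Q).domain.topologicalClosure := by
  have hy : ∀ ξ ∈ Q.domain,
      InnerProductSpace.rankOne ℂ ξ y ∈ (superDer Γ Q).domain.topologicalClosure := fun ξ hξ =>
    map_mem_closure (InnerProductSpace.rankOne ℂ ξ).continuous (hQ.dense_domain y) fun η hη =>
      rankOne_mem_domain_superDer hΓ hΓu hQ hodd ⟨ξ, hξ⟩ ⟨η, hη⟩
  have hcont : Continuous fun ξ : H => InnerProductSpace.rankOne (E := H) (F := H) ℂ ξ y :=
    (continuous_eval_const y).comp (InnerProductSpace.rankOne ℂ).continuous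
  exact (superDer Γ Q).domain.isClosed_topologicalClosure.closure_subset
    (map_mem_closure
      (f := fun ξ : H => InnerProductSpace.rankOne (E := H) (F := H) ℂ ξ y)
      hcont (hQ.dense_domain x) hy)

open ContinuousLinearMap in
theorem dense_domain_superDer (hΓ : IsSelfAdjoint Γ) (hΓu : Γ ∈ unitary (H →L[ℂ] H))
    (hQ : IsSelfAdjoint Q) (hodd : IsOdd Γ Q) :
    Dense (toPointwiseConvergenceCLM ℂ (RingHom.id ℂ) H H ''
      ((superDer Γ Q).domain : Set (H →L[ℂ] H))) := by
  intro (a : H →L[ℂ] H)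
  obtain ⟨w, e, -⟩ := exists_hilbertBasis ℂ H
  -- `s t` is `a` times the projection onto the span of the `e i` with `i ∈ t`, so it tends strongly
  -- to `a`.
  let s : Finset w → H →L[ℂ] H := fun t => ∑ i ∈ t, InnerProductSpace.rankOne ℂ (a (e i)) (e i)
  have hs : Filter.Tendsto
      (fun t => toPointwiseConvergenceCLM ℂ (RingHom.id ℂ) H H (s t)) Filter.atTop (nhds a) := by
    refine PointwiseConvergenceCLM.tendsto_iff_forall_tendsto.2 fun x => ?_
    have hx := (e.hasSum_repr x).mapL a
    refine Filter.Tendsto.congr (fun t => ?_) hx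
    change _ = s t x
    simp [s, e.repr_apply_apply, InnerProductSpace.rankOne_apply]
  refine isClosed_closure.mem_of_tendsto hs (Filter.Eventually.of_forall fun t => ?_)
  -- The strong topology is coarser than the norm topology, so norm closures land in strong
  -- closures.
  refine image_closure_subset_closure_image
    (toPointwiseConvergenceCLM ℂ (RingHom.id ℂ) H H).continuous (Set.mem_image_of_mem _ ?_)
  exact Submodule.sum_mem (superDer Γ Q).domain.topologicalClosure fun i _ =>
    rankOne_mem_closure_domain_superDer hΓ hΓu hQ hodd _ _

/-! ### The Banach *-algebra of the superderivation -/

theorem norm1_eq {a b : H →L[ℂ] H} {ha : a ∈ (superDer Γ Q).domain}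
    (h : superDer Γ Q ⟨a, ha⟩ = b) : norm1 Γ Q ⟨a, ha⟩ = ‖a‖ + ‖b‖ := by
  rw [norm1, h]

theorem superDer_one (hΓ : IsSelfAdjoint Γ) (hΓu : Γ ∈ unitary (H →L[ℂ] H))
    (hQ : IsSelfAdjoint Q) :
    ∃ h : (1 : H →L[ℂ] H) ∈ (superDer Γ Q).domain, superDer Γ Q ⟨1, h⟩ = 0 :=
  (isSuperCommutator_one hΓ hΓu).exists_superDer_eq hQ

theorem superDer_grading (hΓ : IsSelfAdjoint Γ) (hΓu : Γ ∈ unitary (H →L[ℂ] H))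
    (hQ : IsSelfAdjoint Q) (hodd : IsOdd Γ Q) (a : (superDer Γ Q).domain) :
    ∃ h : grading Γ a ∈ (superDer Γ Q).domain,
      superDer Γ Q ⟨grading Γ a, h⟩ = -grading Γ (superDer Γ Q a) :=
  ((isSuperCommutator_superDer hQ a).grading hΓ hΓu hodd).exists_superDer_eq hQ

theorem superDer_star (hΓ : IsSelfAdjoint Γ) (hΓu : Γ ∈ unitary (H →L[ℂ] H))
    (hQ : IsSelfAdjoint Q) (hodd : IsOdd Γ Q) (a : (superDer Γ Q).domain) :
    ∃ h : star (a : H →L[ℂ] H) ∈ (superDer Γ Q).domain,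
      superDer Γ Q ⟨star (a : H →L[ℂ] H), h⟩ = grading Γ (star (superDer Γ Q a)) :=
  ((isSuperCommutator_superDer hQ a).star hΓ hΓu hQ hodd).exists_superDer_eq hQ

theorem superDer_mul (hΓ : IsSelfAdjoint Γ) (hΓu : Γ ∈ unitary (H →L[ℂ] H))
    (hQ : IsSelfAdjoint Q) (a b : (superDer Γ Q).domain) :
    ∃ h : (a * b : H →L[ℂ] H) ∈ (superDer Γ Q).domain,
      superDer Γ Q ⟨a * b, h⟩ = superDer Γ Q a * b + grading Γ a * superDer Γ Q b :=
  ((isSuperCommutator_superDer hQ a).mul hΓ hΓu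
    (isSuperCommutator_superDer hQ b)).exists_superDer_eq hQ

/-- The domain of the superderivation as a unital *-subalgebra of `B(H)`. -/
def superDerSubalgebra (hΓ : IsSelfAdjoint Γ) (hΓu : Γ ∈ unitary (H →L[ℂ] H))
    (hQ : IsSelfAdjoint Q) (hodd : IsOdd Γ Q) : StarSubalgebra ℂ (H →L[ℂ] H) where
  carrier := (superDer Γ Q).domain
  mul_mem' ha hb := (superDer_mul hΓ hΓu hQ ⟨_, ha⟩ ⟨_, hb⟩).1
  one_mem' := (superDer_one hΓ hΓu hQ).1
  add_mem' := (superDer Γ Q).domain.add_mem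
  zero_mem' := (superDer Γ Q).domain.zero_mem
  algebraMap_mem' c := by
    rw [Algebra.algebraMap_eq_smul_one]
    exact (superDer Γ Q).domain.smul_mem c (superDer_one hΓ hΓu hQ).1
  star_mem' ha := (superDer_star hΓ hΓu hQ hodd ⟨_, ha⟩).1

open Filter Topology in
theorem norm1_complete (hΓ : IsSelfAdjoint Γ) (hQ : IsSelfAdjoint Q)
    (x : ℕ → (superDer Γ Q).domain)
    (hx : ∀ ε : ℝ, 0 < ε → ∃ n₀, ∀ m, n₀ ≤ m → ∀ n, n₀ ≤ n → norm1 Γ Q (x m - x n) < ε) :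
    ∃ a, Tendsto (fun n => norm1 Γ Q (x n - a)) atTop (𝓝 0) := by
  have h1 : CauchySeq fun n => (x n : H →L[ℂ] H) := by
    refine Metric.cauchySeq_iff.2 fun ε hε => ?_
    obtain ⟨n₀, h⟩ := hx ε hε
    refine ⟨n₀, fun m hm n hn => ?_⟩
    rw [dist_eq_norm]
    exact lt_of_le_of_lt (le_add_of_nonneg_right (norm_nonneg _)) (h m hm n hn)
  have h2 : CauchySeq fun n => superDer Γ Q (x n) := by
    refine Metric.cauchySeq_iff.2 fun ε hε => ?_
    obtain ⟨n₀, h⟩ := hx ε hε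
    refine ⟨n₀, fun m hm n hn => ?_⟩
    rw [dist_eq_norm, ← LinearPMap.map_sub]
    exact lt_of_le_of_lt (le_add_of_nonneg_left (norm_nonneg _)) (h m hm n hn)
  obtain ⟨a, ha⟩ := cauchySeq_tendsto_of_complete h1
  obtain ⟨b, hb⟩ := cauchySeq_tendsto_of_complete h2
  -- Norm limits are weak limits, so closedness identifies `b` as the value of `δ` at `a`.
  have hab : IsSuperCommutator Γ Q a b :=
    isSuperCommutator_of_tendsto hΓ hQ (fun n => isSuperCommutator_superDer hQ (x n))
      ((ContinuousLinearMapWOT.continuous_ofCLM.tendsto a).comp ha)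
      ((ContinuousLinearMapWOT.continuous_ofCLM.tendsto b).comp hb)
  obtain ⟨hm, e⟩ := hab.exists_superDer_eq hQ
  refine ⟨⟨a, hm⟩, ?_⟩
  have h := (tendsto_iff_norm_sub_tendsto_zero.1 ha).add (tendsto_iff_norm_sub_tendsto_zero.1 hb)
  rw [add_zero] at h
  refine h.congr fun n => ?_
  rw [norm1, LinearPMap.map_sub, e]
  rfl

theorem norm1_grading (hΓ : IsSelfAdjoint Γ) (hΓu : Γ ∈ unitary (H →L[ℂ] H))
    (hQ : IsSelfAdjoint Q) (hodd : IsOdd Γ Q) (a : (superDer Γ Q).domain)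
    (h : grading Γ a ∈ (superDer Γ Q).domain) : norm1 Γ Q ⟨grading Γ a, h⟩ = norm1 Γ Q a := by
  rw [norm1_eq (superDer_grading hΓ hΓu hQ hodd a).2, norm_neg, norm_grading hΓu,
    norm_grading hΓu, norm1]

theorem norm1_star (hΓ : IsSelfAdjoint Γ) (hΓu : Γ ∈ unitary (H →L[ℂ] H))
    (hQ : IsSelfAdjoint Q) (hodd : IsOdd Γ Q) (a : (superDer Γ Q).domain)
    (h : star (a : H →L[ℂ] H) ∈ (superDer Γ Q).domain) :
    norm1 Γ Q ⟨star (a : H →L[ℂ] H), h⟩ = norm1 Γ Q a := by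
  rw [norm1_eq (superDer_star hΓ hΓu hQ hodd a).2, norm_grading hΓu, norm_star, norm_star, norm1]

theorem norm1_mul_le (hΓ : IsSelfAdjoint Γ) (hΓu : Γ ∈ unitary (H →L[ℂ] H))
    (hQ : IsSelfAdjoint Q) (a b : (superDer Γ Q).domain)
    (h : (a * b : H →L[ℂ] H) ∈ (superDer Γ Q).domain) :
    norm1 Γ Q ⟨a * b, h⟩ ≤ norm1 Γ Q a * norm1 Γ Q b := by
  rw [norm1_eq (superDer_mul hΓ hΓu hQ a b).2, norm1, norm1]
  have h1 := norm_mul_le (a : H →L[ℂ] H) (b : H →L[ℂ] H)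
  have h2 := norm_mul_le (superDer Γ Q a) (b : H →L[ℂ] H)
  have h3 := norm_mul_le (grading Γ a) (superDer Γ Q b)
  rw [norm_grading hΓu] at h3
  have h4 := norm_add_le (superDer Γ Q a * (b : H →L[ℂ] H)) (grading Γ a * superDer Γ Q b)
  -- The Leibniz rule accounts for all terms of the expanded product except this one, which is just
  -- discarded.
  have h5 := mul_nonneg (norm_nonneg (superDer Γ Q a)) (norm_nonneg (superDer Γ Q b))
  linarith

theorem isBanachStarAlgebraNorm_norm1 (hΓ : IsSelfAdjoint Γ) (hΓu : Γ ∈ unitary (H →L[ℂ] H))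
    (hQ : IsSelfAdjoint Q) (hodd : IsOdd Γ Q) :
    IsBanachStarAlgebraNorm
      (fun a : superDerSubalgebra hΓ hΓu hQ hodd => norm1 Γ Q ⟨a, a.2⟩) where
  nonneg a := add_nonneg (norm_nonneg _) (norm_nonneg _)
  eq_zero_iff a := by
    constructor
    · intro h
      have h' := ((add_eq_zero_iff_of_nonneg (norm_nonneg _) (norm_nonneg _)).1 h).1
      exact Subtype.ext (norm_eq_zero.1 h')
    · rintro rfl
      have h : superDer Γ Q 0 = 0 := LinearPMap.map_zero _
      exact (norm1_eq h).trans (by simp)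
  add_le a b := by
    refine (norm1_eq ((superDer Γ Q).map_add ⟨a, a.2⟩ ⟨b, b.2⟩)).trans_le ?_
    exact (add_le_add (norm_add_le _ _) (norm_add_le _ _)).trans_eq (add_add_add_comm _ _ _ _)
  smul c a := by
    refine (norm1_eq ((superDer Γ Q).map_smul c ⟨a, a.2⟩)).trans ?_
    exact (congrArg₂ _ (norm_smul _ _) (norm_smul _ _)).trans (mul_add _ _ _).symm
  norm_one hn := by
    have hH : Nontrivial (H →L[ℂ] H) := 
      (Subtype.val_injective (p := (· ∈ superDerSubalgebra hΓ hΓu hQ hodd))).nontrivial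
    refine (norm1_eq (superDer_one hΓ hΓu hQ).2).trans ?_
    rw [norm_zero, add_zero, CStarRing.norm_one]
  mul_le a b := norm1_mul_le hΓ hΓu hQ ⟨a, a.2⟩ ⟨b, b.2⟩ _
  norm_star a := norm1_star hΓ hΓu hQ hodd ⟨a, a.2⟩ _
  complete x hx := by
    obtain ⟨a, ha⟩ := norm1_complete hΓ hQ (fun n => ⟨x n, (x n).2⟩) hx
    exact ⟨⟨a, a.2⟩, ha⟩

end SuperDer

open SuperDer in
theorem proposition2p1 {H : Type*} [NormedAddCommGroup H] [InnerProductSpace ℂ H]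
    [CompleteSpace H] (Γ : H →L[ℂ] H) (hΓ : IsSelfAdjoint Γ) (hΓu : Γ ∈ unitary (H →L[ℂ] H))
    (Q : H →ₗ.[ℂ] H) (hQ : IsSelfAdjoint Q) (hodd : IsOdd Γ Q) :
    -- `δ` is well defined: its graph is exactly the relation `γ(a) Q ⊂ Q a - b`,
    -- which determines `b` uniquely
    (∀ a : H →L[ℂ] H, a ∈ (superDer Γ Q).domain ↔ ∃ b, IsSuperCommutator Γ Q a b) ∧
    (∀ (a : (superDer Γ Q).domain) (b : H →L[ℂ] H),
      IsSuperCommutator Γ Q a b ↔ superDer Γ Q a = b) ∧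
    -- the unit
    (∃ h : (1 : H →L[ℂ] H) ∈ (superDer Γ Q).domain, superDer Γ Q ⟨1, h⟩ = 0) ∧
    -- invariance under `γ`
    (∀ a : (superDer Γ Q).domain, ∃ h : grading Γ a ∈ (superDer Γ Q).domain,
      superDer Γ Q ⟨grading Γ a, h⟩ = -grading Γ (superDer Γ Q a)) ∧
    -- invariance under the involution
    (∀ a : (superDer Γ Q).domain, ∃ h : star (a : H →L[ℂ] H) ∈ (superDer Γ Q).domain,
      superDer Γ Q ⟨star (a : H →L[ℂ] H), h⟩ = grading Γ (star (superDer Γ Q a))) ∧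
    -- graded Leibniz rule
    (∀ a b : (superDer Γ Q).domain, ∃ h : (a * b : H →L[ℂ] H) ∈ (superDer Γ Q).domain,
      superDer Γ Q ⟨a * b, h⟩ = superDer Γ Q a * b + grading Γ a * superDer Γ Q b) ∧
    -- weak-weak closedness, for families along arbitrary filters (in particular, for nets)
    (∀ (ι : Type*) (l : Filter ι) [l.NeBot] (x : ι → (superDer Γ Q).domain) (a b : H →L[ℂ] H),
      Filter.Tendsto (fun i => ContinuousLinearMapWOT.ofCLM (x i : H →L[ℂ] H)) l
        (nhds (ContinuousLinearMapWOT.ofCLM a)) →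
      Filter.Tendsto (fun i => ContinuousLinearMapWOT.ofCLM (superDer Γ Q (x i))) l
        (nhds (ContinuousLinearMapWOT.ofCLM b)) →
      ∃ h : a ∈ (superDer Γ Q).domain, superDer Γ Q ⟨a, h⟩ = b) ∧
    -- density in the strong operator topology
    Dense (ContinuousLinearMap.toPointwiseConvergenceCLM ℂ (RingHom.id ℂ) H H ''
      ((superDer Γ Q).domain : Set (H →L[ℂ] H))) ∧
    -- `γ`-invariance of the norm
    (∀ (a : (superDer Γ Q).domain) (h : grading Γ a ∈ (superDer Γ Q).domain),
      norm1 Γ Q ⟨grading Γ a, h⟩ = norm1 Γ Q a) ∧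
    -- `D(δ)` is a unital *-subalgebra of `B(H)` and a Banach *-algebra for the norm `‖·‖₁`
    (∃ (A : StarSubalgebra ℂ (H →L[ℂ] H)) (hA : ∀ a, a ∈ A ↔ a ∈ (superDer Γ Q).domain),
      IsBanachStarAlgebraNorm (fun a : A => norm1 Γ Q ⟨a, (hA a).1 a.2⟩)) := by
  refine ⟨mem_domain_superDer_iff, fun a b =>
    ⟨fun h => (isSuperCommutator_superDer hQ a).unique hQ h,
    fun h => h ▸ isSuperCommutator_superDer hQ a⟩, superDer_one hΓ hΓu hQ,
    superDer_grading hΓ hΓu hQ hodd, superDer_star hΓ hΓu hQ hodd, superDer_mul hΓ hΓu hQ, ?_,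
    dense_domain_superDer hΓ hΓu hQ hodd, norm1_grading hΓ hΓu hQ hodd,
    superDerSubalgebra hΓ hΓu hQ hodd, fun _ => Iff.rfl,
    isBanachStarAlgebraNorm_norm1 hΓ hΓu hQ hodd⟩
  intro ι l _ x a b hx hy
  exact (isSuperCommutator_of_tendsto hΓ hQ
    (fun i => isSuperCommutator_superDer hQ (x i)) hx hy).exists_superDer_eq hQ
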